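/- Let $\Gamma$ be a compact metric graph: a finite connected graph (loops and multiple edges allowed) with edges $e=1,\dots,E$, the edge $e$ being identified with an interval $[0,l_e]$, $l_e>0$. Let $P_1$ be an orthogonal projector on $\mathbb{C}^{2E}$, put $Q_1=1-P_1$, and let $L_1$ be a self-adjoint linear map on $\ker P_1$. For $F=(f_1,\dots,f_E)\in H^2(\Gamma)=\bigoplus_e H^2(0,l_e)$ write $$F_{bv}=(f_1(0),\dots,f_E(0),f_1(l_1),\dots,f_E(l_E)),\qquad F'_{bv}=(f_1'(0),\dots,f_E'(0),-f_1'(l_1),\dots,-f_E'(l_E)).$$ Let $-\Delta_1$ be the one-particle Laplacian in $L^2(\Gamma)=\bigoplus_e L^2(0,l_e)$, acting as $-\Delta_1F=(-f_1'',\dots,-f_E'')$ on the domain $$\mathcal{D}_1(P_1,L_1)=\{F\in H^2(\Gamma):\ P_1F_{bv}=0,\ Q_1F'_{bv}+L_1Q_1F_{bv}=0\}.$$ Assume that $L_1$ has at least one positive eigenvalue, and let $L_{\max}>0$ be its largest eigenvalue. For $\eta>0$ replace every edge length $l_e$ by $\eta l_e$, keeping $P_1$ and $L_1$ fixed. Then,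 for all sufficiently large $\eta$, the one-particle Laplacian on the scaled graph has a smallest eigenvalue (the ground-state eigenvalue), and it is negative, say $-\kappa_{\min}(\eta)^2$ with $\kappa_{\min}(\eta)>0$; and in the thermodynamical limit $\eta\to\infty$ $$-\kappa_{\min}(\eta)^2\longrightarrow -L_{\max}^2 .$$ -/

import Mathlib

open MeasureTheory Filter Topology Set

namespace QuantumGraph

/-- A compact metric graph: a finite connected graph with vertex set `V` and edge set `E` (the
finiteness of `V` and `E` is required through type classes), in which every edge `e` runs from
`src e` to `tgt e` and is identified with the interval `[0, length e]`.
Loops and multiple edges are allowed. -/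
structure MetricGraph (V E : Type*) where
  src : E → V
  tgt : E → V
  length : E → ℝ
  length_pos : ∀ e, 0 < length e
  connected : ∀ v w : V, Relation.EqvGen (fun a b => ∃ e, src e = a ∧ tgt e = b) v w

/-- The graph in which all edge lengths are multiplied by the common factor `η > 0`. -/
def MetricGraph.scale {V E : Type*} (Γ : MetricGraph V E) (η : ℝ) (hη : 0 < η) :
    MetricGraph V E where
  src := Γ.src
  tgt := Γ.tgt
  length := fun e => η * Γ.length e
  length_pos := fun e => mul_pos hη (Γ.length_pos e)
  connected := Γ.connected

/-- The space `ℂ^{2E}` of boundary values. The coordinate `inl e` belongs to the initial end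
`x = 0` of the edge `e`, and the coordinate `inr e` to its final end `x = l_e`. -/
abbrev BoundarySpace (E : Type*) := EuclideanSpace ℂ (E ⊕ E)

/-- The data of the boundary conditions: an orthogonal projector `P` on the space of boundary
values and a self-adjoint map `L` on `ker P`. -/
structure BoundaryConditions (E : Type*) [Fintype E] where
  P : BoundarySpace E →ₗ[ℂ] BoundarySpace E
  isProjection : P.IsSymmetricProjection
  L : LinearMap.ker P →ₗ[ℂ] LinearMap.ker P
  isSelfAdjoint : ∀ v w : LinearMap.ker P,
    inner ℂ (L v : BoundarySpace E) (w : BoundarySpace E) =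
      inner ℂ (v : BoundarySpace E) (L w : BoundarySpace E)

/-- The complementary projector `Q = 1 - P`, as a map onto `ker P`. -/
def BoundaryConditions.Q {E : Type*} [Fintype E] (B : BoundaryConditions E) :
    BoundarySpace E →ₗ[ℂ] LinearMap.ker B.P :=
  LinearMap.codRestrict (LinearMap.ker B.P) (LinearMap.id - B.P) (by
    intro v
    have h : B.P (B.P v) = B.P v := LinearMap.congr_fun B.isProjection.isIdempotentElem v
    simp [h])

/-- The set of the (real) eigenvalues of the self-adjoint map `L` on `ker P`. -/
def BoundaryConditions.eigenvaluesL {E : Type*} [Fintype E] (B : BoundaryConditions E) : Set ℝ :=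
  {μ : ℝ | Module.End.HasEigenvalue B.L (μ : ℂ)}

/-- `IsH2 a f f' f''` : `f` is the continuously differentiable representative on `[0, a]` of an
element of the Sobolev space `H²(0, a)`, its derivative on `[0, a]` is `f'`, which is absolutely
continuous, and its second weak derivative is `f'' ∈ L²(0, a)`. -/
structure IsH2 (a : ℝ) (f f' f'' : ℝ → ℂ) : Prop where
  memLp : MemLp f'' 2 (volume.restrict (Ioo 0 a))
  eq_integral : ∀ x ∈ Icc 0 a, f x = f 0 + ∫ t in (0 : ℝ)..x, f' t
  deriv_eq_integral : ∀ x ∈ Icc 0 a, f' x = f' 0 + ∫ t in (0 : ℝ)..x, f'' t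

namespace IsH2

variable {a : ℝ} {f f' f'' g g' g'' : ℝ → ℂ}

theorem intervalIntegrable (h : IsH2 a f f' f'') {x : ℝ} (hx : x ∈ Icc 0 a) :
    IntervalIntegrable f'' volume 0 x := by
  have h1 : IntegrableOn f'' (Ioo 0 a) := h.memLp.integrable one_le_two
  have h2 : IntegrableOn f'' (Ioc 0 a) := by
    rwa [integrableOn_Ioc_iff_integrableOn_Ioo]
  exact (intervalIntegrable_iff_integrableOn_Ioc_of_le hx.1).2
    (h2.mono_set (Ioc_subset_Ioc_right hx.2))

theorem continuousOn_deriv (h : IsH2 a f f' f'') : ContinuousOn f' (Icc 0 a) := by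
  rcases lt_or_ge a 0 with ha | ha
  · simp [Icc_eq_empty_of_lt ha]
  have h1 := intervalIntegral.continuousOn_primitive_interval
    (μ := volume) (f := f'') (a := 0) (b := a)
    ((intervalIntegrable_iff' (by simp)).1 (h.intervalIntegrable (right_mem_Icc.2 ha)))
  rw [uIcc_of_le ha] at h1
  exact (continuousOn_const.add h1).congr h.deriv_eq_integral

theorem intervalIntegrable_deriv (h : IsH2 a f f' f'') {x : ℝ} (hx : x ∈ Icc 0 a) :
    IntervalIntegrable f' volume 0 x := by
  apply ContinuousOn.intervalIntegrable
  rw [uIcc_of_le hx.1]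
  exact h.continuousOn_deriv.mono (Icc_subset_Icc_right hx.2)

theorem continuousOn (h : IsH2 a f f' f'') : ContinuousOn f (Icc 0 a) := by
  rcases lt_or_ge a 0 with ha | ha
  · simp [Icc_eq_empty_of_lt ha]
  have h1 := intervalIntegral.continuousOn_primitive_interval
    (μ := volume) (f := f') (a := 0) (b := a)
    ((intervalIntegrable_iff' (by simp)).1 (h.intervalIntegrable_deriv (right_mem_Icc.2 ha)))
  rw [uIcc_of_le ha] at h1
  exact (continuousOn_const.add h1).congr h.eq_integral

theorem zero (a : ℝ) : IsH2 a 0 0 0 where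
  memLp := MemLp.zero'
  eq_integral := by simp
  deriv_eq_integral := by simp

theorem add (hf : IsH2 a f f' f'') (hg : IsH2 a g g' g'') :
    IsH2 a (f + g) (f' + g') (f'' + g'') where
  memLp := hf.memLp.add hg.memLp
  eq_integral x hx := by
    simp only [Pi.add_apply]
    rw [intervalIntegral.integral_add (hf.intervalIntegrable_deriv hx)
      (hg.intervalIntegrable_deriv hx), hf.eq_integral x hx, hg.eq_integral x hx]
    ring
  deriv_eq_integral x hx := by
    simp only [Pi.add_apply]
    rw [intervalIntegral.integral_add (hf.intervalIntegrable hx)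
      (hg.intervalIntegrable hx), hf.deriv_eq_integral x hx, hg.deriv_eq_integral x hx]
    ring

theorem smul (c : ℂ) (hf : IsH2 a f f' f'') : IsH2 a (c • f) (c • f') (c • f'') where
  memLp := hf.memLp.const_smul c
  eq_integral x hx := by
    simp only [Pi.smul_apply]
    rw [intervalIntegral.integral_smul, hf.eq_integral x hx, smul_add]
  deriv_eq_integral x hx := by
    simp only [Pi.smul_apply]
    rw [intervalIntegral.integral_smul, hf.deriv_eq_integral x hx, smul_add]

end IsH2

theorem ae_zero_of_primitive {a : ℝ} {g : ℝ → ℂ} (ha : 0 < a)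
    (hg : IntervalIntegrable g volume 0 a)
    (h : ∀ x ∈ Icc 0 a, ∫ t in (0 : ℝ)..x, g t = 0) :
    g =ᵐ[volume.restrict (Ioo 0 a)] 0 := by
  have h1 := hg.ae_hasDerivAt_integral
  rw [EventuallyEq, ae_restrict_iff' measurableSet_Ioo]
  filter_upwards [h1] with x hx hxa
  have h2 := hx (by rw [uIcc_of_le ha.le]; exact Ioo_subset_Icc_self hxa) 0
    (by rw [uIcc_of_le ha.le]; exact left_mem_Icc.2 ha.le)
  have h3 : (fun y => ∫ t in (0 : ℝ)..y, g t) =ᶠ[𝓝 x] fun _ => 0 := by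
    filter_upwards [Ioo_mem_nhds hxa.1 hxa.2] with y hy
    exact h y (Ioo_subset_Icc_self hy)
  exact h2.unique ((hasDerivAt_const x (0 : ℂ)).congr_of_eventuallyEq h3)

/-- The second weak derivative of an `H²` function is determined by the function. -/
theorem IsH2.ae_zero {a : ℝ} {f f' f'' : ℝ → ℂ} (ha : 0 < a) (h : IsH2 a f f' f'')
    (hf : f =ᵐ[volume.restrict (Ioo 0 a)] 0) : f'' =ᵐ[volume.restrict (Ioo 0 a)] 0 := by
  have key : ∀ {u : ℝ → ℂ}, ContinuousOn u (Icc 0 a) → u =ᵐ[volume.restrict (Ioo 0 a)] 0 →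
      ∀ x ∈ Icc 0 a, u x = 0 := fun {u} hu h0 x hx => by
    refine Measure.eqOn_Icc_of_ae_eq (μ := volume) ha.ne ?_ hu continuousOn_const hx
    rwa [← restrict_Ioo_eq_restrict_Icc]
  have z0 := key h.continuousOn hf
  have z1 := key h.continuousOn_deriv
    (ae_zero_of_primitive ha (h.intervalIntegrable_deriv (right_mem_Icc.2 ha.le))
      fun x hx => by
        have := h.eq_integral x hx
        rwa [z0 x hx, z0 0 (left_mem_Icc.2 ha.le), zero_add, eq_comm] at this)
  exact ae_zero_of_primitive ha (h.intervalIntegrable (right_mem_Icc.2 ha.le)) fun x hx => by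
    have := h.deriv_eq_integral x hx
    rwa [z1 x hx, z1 0 (left_mem_Icc.2 ha.le), zero_add, eq_comm] at this

/-- The boundary values `(f_1(0), …, f_E(0), f_1(l_1), …, f_E(l_E))`. -/
noncomputable def boundaryValues {E : Type*} (l : E → ℝ) (f : E → ℝ → ℂ) : BoundarySpace E :=
  WithLp.toLp 2 (Sum.elim (fun e => f e 0) (fun e => f e (l e)))

/-- The inward derivatives `(f_1'(0), …, f_E'(0), -f_1'(l_1), …, -f_E'(l_E))`, written in terms of
the derivatives `f'` of the components. -/
noncomputable def boundaryDerivatives {E : Type*} (l : E → ℝ) (f' : E → ℝ → ℂ) :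
    BoundarySpace E :=
  WithLp.toLp 2 (Sum.elim (fun e => f' e 0) (fun e => -f' e (l e)))

theorem boundaryValues_zero {E : Type*} (l : E → ℝ) : boundaryValues l 0 = 0 := by
  ext (i | i) <;> simp [boundaryValues]

theorem boundaryValues_add {E : Type*} (l : E → ℝ) (f g : E → ℝ → ℂ) :
    boundaryValues l (f + g) = boundaryValues l f + boundaryValues l g := by
  ext (i | i) <;> simp [boundaryValues]

theorem boundaryValues_smul {E : Type*} (l : E → ℝ) (c : ℂ) (f : E → ℝ → ℂ) :
    boundaryValues l (c • f) = c • boundaryValues l f := by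
  ext (i | i) <;> simp [boundaryValues]

theorem boundaryDerivatives_zero {E : Type*} (l : E → ℝ) : boundaryDerivatives l 0 = 0 := by
  ext (i | i) <;> simp [boundaryDerivatives]

theorem boundaryDerivatives_add {E : Type*} (l : E → ℝ) (f g : E → ℝ → ℂ) :
    boundaryDerivatives l (f + g) = boundaryDerivatives l f + boundaryDerivatives l g := by
  ext (i | i) <;> simp [boundaryDerivatives, add_comm]

theorem boundaryDerivatives_smul {E : Type*} (l : E → ℝ) (c : ℂ) (f : E → ℝ → ℂ) :
    boundaryDerivatives l (c • f) = c • boundaryDerivatives l f := by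
  ext (i | i) <;> simp [boundaryDerivatives]

namespace MetricGraph

variable {V E : Type*}

/-- The one-particle Hilbert space `L²(Γ) = ⨁ₑ L²(0, lₑ)`. -/
abbrev L2 (Γ : MetricGraph V E) : Type _ :=
  PiLp 2 (fun e => Lp ℂ 2 (volume.restrict (Ioo 0 (Γ.length e))))

variable [Fintype E]

/-- `Γ.IsLaplacePair B F G` : the function `F ∈ L²(Γ)` lies in the domain
`{F ∈ H²(Γ) | P F_bv = 0, Q F'_bv + L Q F_bv = 0}`, and `G = (-f_1'', …, -f_E'')`. -/
def IsLaplacePair (Γ : MetricGraph V E) (B : BoundaryConditions E) (F G : Γ.L2) : Prop :=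
  ∃ f f' f'' : E → ℝ → ℂ,
    (∀ e, IsH2 (Γ.length e) (f e) (f' e) (f'' e)) ∧
    (∀ e, F e =ᵐ[volume.restrict (Ioo 0 (Γ.length e))] f e) ∧
    (∀ e, G e =ᵐ[volume.restrict (Ioo 0 (Γ.length e))] -f'' e) ∧
    B.P (boundaryValues Γ.length f) = 0 ∧
    B.Q (boundaryDerivatives Γ.length f') + B.L (B.Q (boundaryValues Γ.length f)) = 0

/-- The graph of the one-particle Laplacian `-Δ₁` with domain `𝒟₁(P, L)`. -/
def laplacianGraph (Γ : MetricGraph V E) (B : BoundaryConditions E) :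
    Submodule ℂ (Γ.L2 × Γ.L2) where
  carrier := {p | Γ.IsLaplacePair B p.1 p.2}
  zero_mem' := by
    refine ⟨0, 0, 0, fun e => IsH2.zero _, fun e => Lp.coeFn_zero _ _ _, fun e => ?_, ?_, ?_⟩
    · simpa using Lp.coeFn_zero ℂ 2 (volume.restrict (Ioo 0 (Γ.length e)))
    · rw [boundaryValues_zero, map_zero]
    · simp only [boundaryValues_zero, boundaryDerivatives_zero, map_zero, add_zero]
  add_mem' := by
    rintro ⟨F, G⟩ ⟨F₂, G₂⟩ ⟨f, f', f'', h, hF, hG, hP, hQ⟩ ⟨g, g', g'', k, kF, kG, kP, kQ⟩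
    refine ⟨f + g, f' + g', f'' + g'', fun e => (h e).add (k e), fun e => ?_, fun e => ?_, ?_, ?_⟩
    · filter_upwards [Lp.coeFn_add (F e) (F₂ e), hF e, kF e] with x h1 h2 h3
      simpa [h2, h3] using h1
    · filter_upwards [Lp.coeFn_add (G e) (G₂ e), hG e, kG e] with x h1 h2 h3
      simpa [h2, h3, add_comm] using h1
    · rw [boundaryValues_add, map_add, hP, kP, add_zero]
    · rw [boundaryValues_add, boundaryDerivatives_add, map_add, map_add, map_add,
        add_add_add_comm, hQ, kQ, add_zero]
  smul_mem' := by
    rintro c ⟨F, G⟩ ⟨f, f', f'', h, hF, hG, hP, hQ⟩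
    refine ⟨c • f, c • f', c • f'', fun e => (h e).smul c, fun e => ?_, fun e => ?_, ?_, ?_⟩
    · filter_upwards [Lp.coeFn_smul c (F e), hF e] with x h1 h2
      simpa [h2] using h1
    · filter_upwards [Lp.coeFn_smul c (G e), hG e] with x h1 h2
      simpa [h2] using h1
    · rw [boundaryValues_smul, map_smul, hP, smul_zero]
    · rw [boundaryValues_smul, boundaryDerivatives_smul, map_smul, map_smul, map_smul,
        ← smul_add, hQ, smul_zero]

/-- The one-particle Laplacian `-Δ₁` with domain `𝒟₁(P, L)`, an unbounded operator in `L²(Γ)`. -/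
noncomputable def laplacian (Γ : MetricGraph V E) (B : BoundaryConditions E) :
    Γ.L2 →ₗ.[ℂ] Γ.L2 :=
  (Γ.laplacianGraph B).toLinearPMap

theorem laplacian_graph (Γ : MetricGraph V E) (B : BoundaryConditions E) :
    (Γ.laplacian B).graph = Γ.laplacianGraph B := by
  apply Submodule.toLinearPMap_graph_eq
  rintro ⟨F, G⟩ ⟨f, f', f'', h, hF, hG, -, -⟩ (hx : F = 0)
  change G = 0
  subst hx
  ext1 e
  apply Lp.ext
  have h0 : f e =ᵐ[volume.restrict (Ioo 0 (Γ.length e))] 0 :=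
    (hF e).symm.trans (Lp.coeFn_zero _ _ _)
  filter_upwards [hG e, (h e).ae_zero (Γ.length_pos e) h0,
    Lp.coeFn_zero ℂ 2 (volume.restrict (Ioo 0 (Γ.length e)))] with x h1 h2 h3
  rw [h1]
  rw [Pi.neg_apply, h2]
  simpa using h3.symm

/-- The pairs `(F, -Δ₁ F)`, `F ∈ 𝒟₁(P, L)`, are exactly the ones described above. -/
theorem mem_laplacian_graph (Γ : MetricGraph V E) (B : BoundaryConditions E) (F G : Γ.L2) :
    (∃ hF : F ∈ (Γ.laplacian B).domain, Γ.laplacian B ⟨F, hF⟩ = G) ↔ Γ.IsLaplacePair B F G := by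
  have h : (F, G) ∈ (Γ.laplacian B).graph ↔ Γ.IsLaplacePair B F G := by
    rw [laplacian_graph]; rfl
  rw [← h, LinearPMap.mem_graph_iff]
  constructor
  · rintro ⟨hF, rfl⟩
    exact ⟨⟨F, hF⟩, rfl, rfl⟩
  · rintro ⟨⟨y, hy⟩, rfl, rfl⟩
    exact ⟨hy, rfl⟩

end MetricGraph

/-- The set of the real eigenvalues of an unbounded operator. -/
def eigenvalues {H : Type*} [AddCommGroup H] [Module ℂ H] (A : H →ₗ.[ℂ] H) : Set ℝ :=
  {μ : ℝ | ∃ F : A.domain, (F : H) ≠ 0 ∧ A F = (μ : ℂ) • (F : H)}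

end QuantumGraph

namespace QuantumGraph

/-! An eigenfunction for `-κ ^ 2`, `κ > 0`, solves `f'' = κ² f` on every edge. Since `sinh (κ a) ≠
0`, it is determined by its boundary values `v`, which lie in `ker P`, and its inward derivatives
are `-M(κ) v` with `M(κ)` the Dirichlet-to-Neumann map `dtn`. The boundary conditions become `(Q
M(κ) - L) v = 0`, so the negative eigenvalues are read off from the singular points of a family of
symmetric maps on the finite-dimensional space `ker P` (`neg_sq_mem_eigenvalues_iff`).

An edge of length `a` contributes to `M(κ)` a 2×2 block with eigenvalues `κ tanh (κ a / 2)` and `κ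
coth (κ a / 2)`. Both tend to `κ` as the lengths grow, so the family approaches `κ - L`, whose
largest singular point is `Lmax`.

To make this precise, take `0 < a < Lmax < b`. For large `η` the form of `Q M(κ) - L` is nonpositive
at `κ = a` on an eigenvector of `Lmax`, and positive definite for all `κ ≥ b`. By compactness and
continuity there is a largest singular `κ`, and it lies in `[a, b]` (`exists_isGreatest_singular`).
The largest `κ` gives the least eigenvalue `-κ ^ 2`, and `a`, `b` can be taken arbitrarily close to
`Lmax`. No spectral theory of the unbounded operator is needed. -/

theorem hasDerivWithinAt_of_eq_integral {a : ℝ} {u w : ℝ → ℂ} (hw : ContinuousOn w (Icc 0 a))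
    (hu : ∀ x ∈ Icc 0 a, u x = u 0 + ∫ t in (0 : ℝ)..x, w t) {x : ℝ} (hx : x ∈ Icc 0 a) :
    HasDerivWithinAt u (w x) (Icc 0 a) x := by
  have : Fact (x ∈ Icc 0 a) := ⟨hx⟩
  have hint : IntervalIntegrable w volume 0 x := by
    apply ContinuousOn.intervalIntegrable
    rw [uIcc_of_le hx.1]
    exact hw.mono (Icc_subset_Icc_right hx.2)
  have h1 := intervalIntegral.integral_hasDerivWithinAt_right hint (s := Icc 0 a) (t := Icc 0 a)
    (hw.stronglyMeasurableAtFilter_nhdsWithin measurableSet_Icc x) (hw x hx)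
  exact (h1.const_add (u 0)).congr hu (hu x hx)

theorem IsH2.hasDerivWithinAt {a : ℝ} {f f' f'' : ℝ → ℂ} (h : IsH2 a f f' f'') {x : ℝ}
    (hx : x ∈ Icc 0 a) : HasDerivWithinAt f (f' x) (Icc 0 a) x :=
  hasDerivWithinAt_of_eq_integral h.continuousOn_deriv h.eq_integral hx

/-- The eigenvalue equation holds only almost everywhere; this allows the weak second derivative to
be replaced by the continuous function `κ² f`. -/
theorem IsH2.congr_ae {a : ℝ} {f f' f'' g : ℝ → ℂ} (h : IsH2 a f f' f'')
    (hg : f'' =ᵐ[volume.restrict (Ioo 0 a)] g) : IsH2 a f f' g where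
  memLp := h.memLp.ae_eq hg
  eq_integral := h.eq_integral
  deriv_eq_integral x hx := by
    rw [h.deriv_eq_integral x hx]
    congr 1
    apply intervalIntegral.integral_congr_ae_restrict
    rw [uIoc_of_le hx.1, ← restrict_Ioo_eq_restrict_Ioc]
    exact ae_restrict_of_ae_restrict_of_subset (Ioo_subset_Ioo_right hx.2) hg

theorem IsH2.of_contDiff {a : ℝ} {f f' f'' : ℝ → ℂ} (h : ∀ x, HasDerivAt f (f' x) x)
    (h' : ∀ x, HasDerivAt f' (f'' x) x) (hf'' : Continuous f'') : IsH2 a f f' f'' where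
  memLp := by
    obtain ⟨C, hC⟩ := (isCompact_Icc (a := (0 : ℝ)) (b := a)).exists_bound_of_continuousOn
      hf''.continuousOn
    refine MemLp.of_bound hf''.aestronglyMeasurable C ?_
    filter_upwards [ae_restrict_mem measurableSet_Ioo] with x hx
    exact hC x (Ioo_subset_Icc_self hx)
  eq_integral x _ := by
    have hc : Continuous f' := continuous_iff_continuousAt.2 fun x => (h' x).continuousAt
    rw [intervalIntegral.integral_eq_sub_of_hasDerivAt (fun y _ => h y) (hc.intervalIntegrable _ _)]
    ring
  deriv_eq_integral x _ := by
    rw [intervalIntegral.integral_eq_sub_of_hasDerivAt (fun y _ => h' y)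
      (hf''.intervalIntegrable _ _)]
    ring

theorem eq_zero_of_hasDerivWithinAt_zero {a : ℝ} {u : ℝ → ℂ}
    (h : ∀ x ∈ Icc 0 a, HasDerivWithinAt u 0 (Icc 0 a) x) : ∀ x ∈ Icc 0 a, u x = u 0 := by
  refine constant_of_derivWithin_zero (fun x hx => (h x hx).differentiableWithinAt) fun x hx => ?_
  have hx' := Ico_subset_Icc_self hx
  exact (h x hx').derivWithin (uniqueDiffOn_Icc (hx.1.trans_lt hx.2) x hx')

/-! ### Solutions of `f'' = κ² f` on an edge -/

theorem hasDerivAt_cosh_mul (κ x : ℝ) :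
    HasDerivAt (fun x : ℝ => (Real.cosh (κ * x) : ℂ)) (κ * Real.sinh (κ * x) : ℂ) x := by
  have := ((hasDerivAt_id x).const_mul κ).cosh.ofReal_comp
  simpa [mul_comm] using this

theorem hasDerivAt_sinh_mul (κ x : ℝ) :
    HasDerivAt (fun x : ℝ => (Real.sinh (κ * x) : ℂ)) (κ * Real.cosh (κ * x) : ℂ) x := by
  have := ((hasDerivAt_id x).const_mul κ).sinh.ofReal_comp
  simpa [mul_comm] using this

/-- The first integrals of the equation `f'' = κ² f`. -/
theorem IsH2.first_integrals {a κ : ℝ} {f f' : ℝ → ℂ}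
    (h : IsH2 a f f' fun x => (κ : ℂ) ^ 2 * f x) {x : ℝ} (hx : x ∈ Icc 0 a) :
    f' x * Real.cosh (κ * x) - κ * f x * Real.sinh (κ * x) = f' 0 ∧
      κ * f x * Real.cosh (κ * x) - f' x * Real.sinh (κ * x) = κ * f 0 := by
  have hf : ∀ y ∈ Icc 0 a, HasDerivWithinAt f (f' y) (Icc 0 a) y :=
    fun y hy => h.hasDerivWithinAt hy
  have hf' : ∀ y ∈ Icc 0 a, HasDerivWithinAt f' ((κ : ℂ) ^ 2 * f y) (Icc 0 a) y :=
    fun y hy => hasDerivWithinAt_of_eq_integral (continuousOn_const.mul h.continuousOn)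
      h.deriv_eq_integral hy
  -- Both expressions have zero derivative by `f'' = κ² f`. They come from applying the inverse
  -- hyperbolic rotation to `(f', κ f)`.
  constructor
  · have := eq_zero_of_hasDerivWithinAt_zero
      (u := fun x => f' x * Real.cosh (κ * x) - κ * f x * Real.sinh (κ * x)) (a := a)
      (fun y hy => by
        convert! ((hf' y hy).mul (hasDerivAt_cosh_mul κ y).hasDerivWithinAt).sub
          (((hf y hy).const_mul (κ : ℂ)).mul (hasDerivAt_sinh_mul κ y).hasDerivWithinAt) using 1
        ring) x hx
    simpa using this
  · have := eq_zero_of_hasDerivWithinAt_zero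
      (u := fun x => κ * f x * Real.cosh (κ * x) - f' x * Real.sinh (κ * x)) (a := a)
      (fun y hy => by
        convert! (((hf y hy).const_mul (κ : ℂ)).mul (hasDerivAt_cosh_mul κ y).hasDerivWithinAt).sub
          ((hf' y hy).mul (hasDerivAt_sinh_mul κ y).hasDerivWithinAt) using 1
        ring) x hx
    simpa using this

/-! ### The Dirichlet-to-Neumann map -/

/-- The diagonal entry `κ coth (κ a)` of the Dirichlet-to-Neumann map of an edge of length `a`. -/
noncomputable def dtnDiag (a κ : ℝ) : ℝ := κ * Real.cosh (κ * a) / Real.sinh (κ * a)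

/-- Minus the off-diagonal entry of the Dirichlet-to-Neumann map of an edge of length `a`. -/
noncomputable def dtnOff (a κ : ℝ) : ℝ := κ / Real.sinh (κ * a)

/-- The map which sends the boundary values of a solution of `F'' = κ² F` to minus its inward
boundary derivatives. -/
noncomputable def dtn {E : Type*} (l : E → ℝ) (κ : ℝ) : BoundarySpace E →ₗ[ℂ] BoundarySpace E where
  toFun v := WithLp.toLp 2 (Sum.elim
    (fun e => dtnDiag (l e) κ * v (Sum.inl e) - dtnOff (l e) κ * v (Sum.inr e))
    (fun e => dtnDiag (l e) κ * v (Sum.inr e) - dtnOff (l e) κ * v (Sum.inl e)))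
  map_add' v w := by
    ext (e | e) <;> simp <;> ring
  map_smul' c v := by
    ext (e | e) <;> simp <;> ring

section

variable {E : Type*} (l : E → ℝ) (κ : ℝ) (v : BoundarySpace E) (e : E)

@[simp] theorem dtn_inl : dtn l κ v (Sum.inl e) =
    dtnDiag (l e) κ * v (Sum.inl e) - dtnOff (l e) κ * v (Sum.inr e) := rfl

@[simp] theorem dtn_inr : dtn l κ v (Sum.inr e) =
    dtnDiag (l e) κ * v (Sum.inr e) - dtnOff (l e) κ * v (Sum.inl e) := rfl

end

theorem sinh_mul_ne_zero {a κ : ℝ} (ha : 0 < a) (hκ : 0 < κ) : (Real.sinh (κ * a) : ℂ) ≠ 0 := by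
  exact_mod_cast (Real.sinh_pos_iff.2 (mul_pos hκ ha)).ne'

theorem ofReal_cosh_sq (x : ℝ) : (Real.cosh x : ℂ) ^ 2 = (Real.sinh x : ℂ) ^ 2 + 1 := by
  exact_mod_cast Real.cosh_sq x

/-- The first integrals at the final end of an edge are two linear equations for the derivatives at
its two ends, solvable because `sinh (κ a) ≠ 0`. -/
theorem boundaryDerivatives_eq_neg_dtn {E : Type*} {l : E → ℝ} (hl : ∀ e, 0 < l e) {κ : ℝ}
    (hκ : 0 < κ) {f f' : E → ℝ → ℂ}
    (h : ∀ e, IsH2 (l e) (f e) (f' e) fun x => (κ : ℂ) ^ 2 * f e x) :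
    boundaryDerivatives l f' = -dtn l κ (boundaryValues l f) := by
  have key (e : E) : f' e 0 = -(dtnDiag (l e) κ * f e 0 - dtnOff (l e) κ * f e (l e)) ∧
      -f' e (l e) = -(dtnDiag (l e) κ * f e (l e) - dtnOff (l e) κ * f e 0) := by
    obtain ⟨h1, h2⟩ := (h e).first_integrals (right_mem_Icc.2 (hl e).le)
    have hs := sinh_mul_ne_zero (hl e) hκ
    have hc := ofReal_cosh_sq (κ * l e)
    simp only [dtnDiag, dtnOff, Complex.ofReal_div, Complex.ofReal_mul]
    constructor
    · field_simp
      linear_combination (-(Real.sinh (κ * l e) : ℂ)) * h1 - (Real.cosh (κ * l e) : ℂ) * h2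
        + κ * f e (l e) * hc
    · field_simp
      linear_combination h2
  ext (e | e)
  · simpa [boundaryDerivatives, boundaryValues] using (key e).1
  · simpa [boundaryDerivatives, boundaryValues] using (key e).2

/-- With zero boundary values the first integrals at `a` give `f' a = 0` and then `f' 0 = 0`. Both
first integrals therefore vanish identically, and `cosh² - sinh² = 1` forces `f = 0`. Hence a
nonzero eigenfunction has nonzero boundary values. -/
theorem IsH2.eq_zero_of_boundary {a κ : ℝ} (ha : 0 < a) (hκ : 0 < κ) {f f' : ℝ → ℂ}
    (h : IsH2 a f f' fun x => (κ : ℂ) ^ 2 * f x) (h0 : f 0 = 0) (h1 : f a = 0) :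
    ∀ x ∈ Icc 0 a, f x = 0 := by
  intro x hx
  have hκ' : (κ : ℂ) ≠ 0 := by exact_mod_cast hκ.ne'
  have hd : f' 0 = 0 := by
    obtain ⟨e1, e2⟩ := h.first_integrals (right_mem_Icc.2 ha.le)
    rw [h1, h0] at e2
    rw [h1] at e1
    have : f' a = 0 := by
      have : f' a * Real.sinh (κ * a) = 0 := by linear_combination -e2
      exact (mul_eq_zero.1 this).resolve_right (sinh_mul_ne_zero ha hκ)
    rw [← e1, this]
    simp
  obtain ⟨e1, e2⟩ := h.first_integrals hx
  rw [hd] at e1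
  rw [h0] at e2
  refine (mul_eq_zero.1 (?_ : (κ : ℂ) * f x = 0)).resolve_left hκ'
  linear_combination (Real.sinh (κ * x) : ℂ) * e1 + (Real.cosh (κ * x) : ℂ) * e2
    - κ * f x * ofReal_cosh_sq (κ * x)

/-- The solution of `f'' = κ² f` on `[0, a]` with boundary values `y` and `z`. -/
theorem exists_isH2_boundary {a κ : ℝ} (ha : 0 < a) (hκ : 0 < κ) (y z : ℂ) :
    ∃ f f' : ℝ → ℂ, IsH2 a f f' (fun x => (κ : ℂ) ^ 2 * f x) ∧ f 0 = y ∧ f a = z := by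
  have hs := sinh_mul_ne_zero ha hκ
  have hκ' : (κ : ℂ) ≠ 0 := by exact_mod_cast hκ.ne'
  set c := (z - y * Real.cosh (κ * a)) / (Real.sinh (κ * a) : ℂ) with hc
  have h1 (x : ℝ) : HasDerivAt (fun x : ℝ => y * Real.cosh (κ * x) + c * Real.sinh (κ * x))
      (y * (κ * Real.sinh (κ * x)) + c * (κ * Real.cosh (κ * x))) x :=
    ((hasDerivAt_cosh_mul κ x).const_mul y).add ((hasDerivAt_sinh_mul κ x).const_mul c)
  refine ⟨_, _, IsH2.of_contDiff h1 (fun x => ?_) ?_, by simp, ?_⟩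
  · convert! (((hasDerivAt_sinh_mul κ x).const_mul (κ : ℂ)).const_mul y).add
      (((hasDerivAt_cosh_mul κ x).const_mul (κ : ℂ)).const_mul c) using 1
    ring
  · have : Continuous fun x : ℝ => y * Real.cosh (κ * x) + c * Real.sinh (κ * x) :=
      continuous_iff_continuousAt.2 fun x => (h1 x).continuousAt
    exact continuous_const.mul this
  · simp only [hc]
    field_simp
    ring

/-! ### The secular equation on `ker P` -/

section

variable {E : Type*} [Fintype E] (B : BoundaryConditions E)

/-- The compression of the Dirichlet-to-Neumann map to `ker P`, minus `L`. -/
noncomputable def BoundaryConditions.secular (l : E → ℝ) (κ : ℝ) :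
    LinearMap.ker B.P →ₗ[ℂ] LinearMap.ker B.P :=
  B.Q ∘ₗ dtn l κ ∘ₗ (LinearMap.ker B.P).subtype - B.L

theorem BoundaryConditions.Q_coe (v : BoundarySpace E) : (B.Q v : BoundarySpace E) = v - B.P v :=
  rfl

theorem BoundaryConditions.Q_of_mem (v : LinearMap.ker B.P) : B.Q (v : BoundarySpace E) = v := by
  ext1
  rw [B.Q_coe, LinearMap.mem_ker.1 v.2, sub_zero]

/-- Eigenfunctions and kernel vectors correspond through boundary values: the Dirichlet problem for
`f'' = κ² f` is uniquely solvable on each edge, and the remaining boundary condition is, up to sign,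
the secular equation. -/
theorem neg_sq_mem_eigenvalues_iff {V : Type*} (Γ : MetricGraph V E) {κ : ℝ} (hκ : 0 < κ) :
    -κ ^ 2 ∈ eigenvalues (Γ.laplacian B) ↔
      ∃ v : LinearMap.ker B.P, v ≠ 0 ∧ B.secular Γ.length κ v = 0 := by
  have hl := Γ.length_pos
  constructor
  · rintro ⟨⟨F, hF⟩, hF0, hAF⟩
    obtain ⟨f, f', f'', h, hf, hf'', hP, hQ⟩ := (Γ.mem_laplacian_graph B F _).1 ⟨hF, hAF⟩
    have hH (e : E) : IsH2 (Γ.length e) (f e) (f' e) fun x => (κ : ℂ) ^ 2 * f e x := by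
      refine (h e).congr_ae ?_
      filter_upwards [hf'' e, hf e, Lp.coeFn_smul ((-κ ^ 2 : ℝ) : ℂ) (F e)] with x h1 h2 h3
      have h4 : ((-κ ^ 2 : ℝ) : ℂ) * f e x = -f'' e x := by
        rw [← h2]
        exact h3.symm.trans h1
      push_cast at h4
      linear_combination h4
    refine ⟨⟨boundaryValues Γ.length f, hP⟩, fun h0 => hF0 ?_, ?_⟩
    · have h0' : boundaryValues Γ.length f = 0 := congrArg Subtype.val h0
      change F = 0
      ext1 e
      apply Lp.ext
      have hz := (hH e).eq_zero_of_boundary (hl e) hκ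
        (by simpa [boundaryValues] using congrArg (fun w : BoundarySpace E => w (Sum.inl e)) h0')
        (by simpa [boundaryValues] using congrArg (fun w : BoundarySpace E => w (Sum.inr e)) h0')
      filter_upwards [hf e, Lp.coeFn_zero ℂ 2 (volume.restrict (Ioo 0 (Γ.length e))),
        ae_restrict_mem measurableSet_Ioo] with x h1 h2 h3
      rw [h1, hz x (Ioo_subset_Icc_self h3)]
      exact h2.symm
    · rw [boundaryDerivatives_eq_neg_dtn hl hκ hH, map_neg] at hQ
      have := B.Q_of_mem ⟨boundaryValues Γ.length f, hP⟩
      rw [this] at hQ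
      simp only [BoundaryConditions.secular, LinearMap.sub_apply, LinearMap.comp_apply,
        Submodule.subtype_apply]
      rw [← neg_eq_zero, ← hQ]
      abel
  · rintro ⟨v, hv0, hv⟩
    choose f f' h hf0 hf1 using fun e => exists_isH2_boundary (hl e) hκ
      ((v : BoundarySpace E) (Sum.inl e)) ((v : BoundarySpace E) (Sum.inr e))
    have hbv : boundaryValues Γ.length f = v := by
      ext (e | e) <;> simp [boundaryValues, hf0, hf1]
    have hmem (e : E) : MemLp (f e) 2 (volume.restrict (Ioo 0 (Γ.length e))) := by
      have hκ' : (κ : ℂ) ^ 2 ≠ 0 := pow_ne_zero 2 (by exact_mod_cast hκ.ne')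
      -- `IsH2` records square integrability only of the second derivative, here `κ² f`; dividing by
      -- `κ²` gives it for `f`.
      convert! (h e).memLp.const_mul ((κ : ℂ) ^ 2)⁻¹ using 1
      ext x
      exact (inv_mul_cancel_left₀ hκ' _).symm
    let F : Γ.L2 := WithLp.toLp 2 fun e => (hmem e).toLp (f e)
    have hFe (e : E) : F e =ᵐ[volume.restrict (Ioo 0 (Γ.length e))] f e := (hmem e).coeFn_toLp
    obtain ⟨hF, hAF⟩ := (Γ.mem_laplacian_graph B F (((-κ ^ 2 : ℝ) : ℂ) • F)).2
      ⟨f, f', _, h, hFe, fun e => by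
        filter_upwards [hFe e, Lp.coeFn_smul ((-κ ^ 2 : ℝ) : ℂ) (F e)] with x h1 h2
        have h3 : (((-κ ^ 2 : ℝ) : ℂ) • F) e x = ((-κ ^ 2 : ℝ) : ℂ) * F e x := by
          simpa using h2
        rw [h3, h1]
        simp, by rw [hbv]; exact v.2, by
        rw [boundaryDerivatives_eq_neg_dtn hl hκ h, hbv, B.Q_of_mem, map_neg]
        have : B.Q (dtn Γ.length κ v) - B.L v = 0 := hv
        rw [← neg_eq_zero, ← this]
        abel⟩
    refine ⟨⟨F, hF⟩, fun h0 => hv0 ?_, hAF⟩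
    change F = 0 at h0
    -- By continuity, vanishing almost everywhere in the interior extends to the endpoints, where
    -- the boundary values are taken.
    have hz (e : E) : ∀ x ∈ Icc 0 (Γ.length e), f e x = 0 := by
      intro x hx
      refine Measure.eqOn_Icc_of_ae_eq (μ := volume) (hl e).ne ?_ (h e).continuousOn
        (continuousOn_const (c := (0 : ℂ))) hx
      rw [← restrict_Ioo_eq_restrict_Icc]
      filter_upwards [hFe e, Lp.coeFn_zero ℂ 2 (volume.restrict (Ioo 0 (Γ.length e)))] with x h1 h2
      rw [← h1, h0]
      exact h2
    ext1
    rw [← hbv]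
    ext (e | e)
    · simpa [boundaryValues] using hz e 0 (left_mem_Icc.2 (hl e).le)
    · simpa [boundaryValues] using hz e _ (right_mem_Icc.2 (hl e).le)

end

end QuantumGraph

namespace QuantumGraph

/-! ### Quadratic forms of symmetric maps -/

/-- Along `v + t T v` the form is a quadratic polynomial in `t` with zero constant term and linear
coefficient `2 ‖T v‖²`. It is nonnegative for all real `t`, so its discriminant forces this
coefficient to vanish. -/
theorem apply_eq_zero_of_re_inner_eq_zero {K : Type*} [NormedAddCommGroup K] [InnerProductSpace ℂ K]
    {T : K →ₗ[ℂ] K} (hT : T.IsSymmetric) (hpos : ∀ v, 0 ≤ (inner ℂ v (T v)).re) {v : K}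
    (hv : (inner ℂ v (T v)).re = 0) : T v = 0 := by
  have key (t : ℝ) : 0 ≤ (inner ℂ (T v) (T (T v))).re * (t * t) + (2 * ‖T v‖ ^ 2) * t + 0 := by
    have h := hpos (v + (t : ℂ) • T v)
    have h1 : inner ℂ v (T (T v)) = (‖T v‖ ^ 2 : ℂ) := by
      rw [← hT v (T v), inner_self_eq_norm_sq_to_K]; rfl
    have h2 : inner ℂ (T v) (T v) = (‖T v‖ ^ 2 : ℂ) := inner_self_eq_norm_sq_to_K _
    rw [map_add, map_smul, inner_add_left, inner_add_right, inner_add_right, inner_smul_left,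
      inner_smul_left, inner_smul_right, inner_smul_right, h1, h2, Complex.conj_ofReal] at h
    simp only [Complex.add_re, Complex.re_ofReal_mul, hv] at h
    have h3 : ((‖T v‖ : ℂ) ^ 2).re = ‖T v‖ ^ 2 := by norm_cast
    rw [h3] at h
    linarith
  have := discrim_le_zero key
  simp only [discrim, mul_zero, sub_zero] at this
  have : 2 * ‖T v‖ ^ 2 = 0 := by
    have := pow_eq_zero_iff (two_ne_zero) |>.1 (le_antisymm this (sq_nonneg _))
    exact this
  simpa using this

/-- The largest parameter at which a continuous family of symmetric maps, which is positive
definite for large values of the parameter, is singular. -/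
theorem exists_isGreatest_singular {K : Type*} [NormedAddCommGroup K] [InnerProductSpace ℂ K]
    [FiniteDimensional ℂ K] {T : ℝ → K →ₗ[ℂ] K} (hT : ∀ κ, (T κ).IsSymmetric) {a b : ℝ}
    (hcont : ContinuousOn (fun p : ℝ × K => (inner ℂ p.2 (T p.1 p.2)).re) (Icc a b ×ˢ univ))
    (hab : a ≤ b) (ha : ∃ v, v ≠ 0 ∧ (inner ℂ v (T a v)).re ≤ 0)
    (hb : ∀ κ, b ≤ κ → ∀ v, v ≠ 0 → 0 < (inner ℂ v (T κ v)).re) :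
    ∃ κ ∈ Icc a b, IsGreatest {κ | a ≤ κ ∧ ∃ v, v ≠ 0 ∧ T κ v = 0} κ := by
  have hscale (κ : ℝ) (c : ℝ) (v : K) :
      (inner ℂ ((c : ℂ) • v) (T κ ((c : ℂ) • v))).re = c ^ 2 * (inner ℂ v (T κ v)).re := by
    rw [map_smul, inner_smul_left, inner_smul_right, Complex.conj_ofReal, Complex.re_ofReal_mul,
      Complex.re_ofReal_mul]
    ring
  have hunit {κ : ℝ} {v : K} (hv : v ≠ 0) (h : (inner ℂ v (T κ v)).re ≤ 0) :
      ∃ w ∈ Metric.sphere (0 : K) 1, (inner ℂ w (T κ w)).re ≤ 0 := by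
    refine ⟨((‖v‖⁻¹ : ℝ) : ℂ) • v, ?_, ?_⟩
    · simp [norm_smul, norm_ne_zero_iff.2 hv]
    · rw [hscale]
      exact mul_nonpos_of_nonneg_of_nonpos (sq_nonneg _) h
  have : ProperSpace K := FiniteDimensional.proper_rclike ℂ K
  -- The pairs of a parameter and a unit vector at which the form is nonpositive. `S` is compact, so
  -- its parameters have a largest element, which is the required one.
  set S : Set (ℝ × K) := (Icc a b ×ˢ Metric.sphere (0 : K) 1) ∩
    (fun p : ℝ × K => (inner ℂ p.2 (T p.1 p.2)).re) ⁻¹' Iic 0 with hS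
  have hcompact : IsCompact (Icc a b ×ˢ Metric.sphere (0 : K) 1) :=
    isCompact_Icc.prod (isCompact_sphere _ _)
  have hSc : IsCompact S := hcompact.of_isClosed_subset
    ((hcont.mono (prod_mono_right (subset_univ _))).preimage_isClosed_of_isClosed
      hcompact.isClosed isClosed_Iic) inter_subset_left
  have hSne : S.Nonempty := by
    obtain ⟨v, hv, h⟩ := ha
    obtain ⟨w, hw, h'⟩ := hunit hv h
    exact ⟨(a, w), ⟨left_mem_Icc.2 hab, hw⟩, h'⟩
  obtain ⟨κ, ⟨⟨κ', w⟩, ⟨⟨hκ, hw⟩, hκw⟩, rfl⟩, hmax⟩ :=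
    (hSc.image continuous_fst).exists_isGreatest (hSne.image _)
  change κ' ∈ Icc a b at hκ
  change (inner ℂ w (T κ' w)).re ≤ 0 at hκw
  change w ∈ Metric.sphere (0 : K) 1 at hw
  have hw0 : w ≠ 0 := by rintro rfl; simp at hw
  have hgt : ∀ κ, κ' < κ → ∀ v, v ≠ 0 → 0 < (inner ℂ v (T κ v)).re := by
    intro κ hlt v hv
    by_contra! hle
    rcases le_or_gt b κ with hbκ | hbκ
    · exact absurd (hb κ hbκ v hv) hle.not_gt
    · obtain ⟨u, hu, hle'⟩ := hunit hv hle
      exact absurd (hmax ⟨(κ, u), ⟨⟨⟨hκ.1.trans hlt.le, hbκ.le⟩, hu⟩, hle'⟩, rfl⟩) hlt.not_ge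
  -- Strictness leaves parameters in `(κ', b)`, where the form is positive definite; letting them
  -- decrease to `κ'` shows the form is nonnegative there. Then `w` is a null vector of a
  -- nonnegative form, hence in the kernel.
  have hlt : κ' < b := by
    refine hκ.2.lt_of_ne ?_
    rintro rfl
    exact absurd (hb _ le_rfl w hw0) hκw.not_gt
  have hnonneg (v : K) : 0 ≤ (inner ℂ v (T κ' v)).re := by
    have hc : ContinuousOn (fun κ => (inner ℂ v (T κ v)).re) (Icc a b) :=
      hcont.comp (f := fun κ => (κ, v)) (by fun_prop) fun x hx => ⟨hx, mem_univ _⟩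
    have hc' : Tendsto (fun κ => (inner ℂ v (T κ v)).re) (𝓝[Ioo κ' b] κ')
        (𝓝 (inner ℂ v (T κ' v)).re) :=
      (hc κ' hκ).mono_left (nhdsWithin_mono _ fun x hx => ⟨hκ.1.trans hx.1.le, hx.2.le⟩)
    have : (𝓝[Ioo κ' b] κ').NeBot := left_nhdsWithin_Ioo_neBot hlt
    refine ge_of_tendsto hc' ?_
    filter_upwards [self_mem_nhdsWithin] with κ h1
    rcases eq_or_ne v 0 with rfl | hv
    · simp
    · exact (hgt κ h1.1 v hv).le
  refine ⟨κ', hκ, ⟨hκ.1, w, hw0, apply_eq_zero_of_re_inner_eq_zero (hT κ') hnonneg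
    (le_antisymm hκw (hnonneg w))⟩, ?_⟩
  rintro κ ⟨-, v, hv, h0⟩
  by_contra! hlt'
  have := hgt κ hlt' v hv
  simp [h0] at this

/-- In finite dimension the supremum of the Rayleigh quotient is itself an eigenvalue, so it is at
most `m`. -/
theorem re_inner_le_of_forall_hasEigenvalue {K : Type*} [NormedAddCommGroup K]
    [InnerProductSpace ℂ K] [FiniteDimensional ℂ K] {T : K →ₗ[ℂ] K} (hT : T.IsSymmetric) {m : ℝ}
    (hm : ∀ μ : ℝ, Module.End.HasEigenvalue T (μ : ℂ) → μ ≤ m) (v : K) :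
    (inner ℂ v (T v)).re ≤ m * ‖v‖ ^ 2 := by
  rcases eq_or_ne v 0 with rfl | hv
  · simp
  have : Nontrivial K := ⟨v, 0, hv⟩
  have h1 := hm _ hT.hasEigenvalue_iSup_of_finiteDimensional
  -- Boundedness is needed because a real supremum bounds its family only when the family is bounded
  -- above.
  have hb : BddAbove (range fun x : { x : K // x ≠ 0 } =>
      RCLike.re (inner ℂ (T x) (x : K)) / ‖(x : K)‖ ^ 2) := by
    refine ⟨‖LinearMap.toContinuousLinearMap T‖, ?_⟩
    rintro _ ⟨⟨x, hx⟩, rfl⟩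
    have hx' : 0 < ‖x‖ := norm_pos_iff.2 hx
    rw [div_le_iff₀ (by positivity)]
    calc RCLike.re (inner ℂ (T x) x) ≤ ‖T x‖ * ‖x‖ := re_inner_le_norm _ _
      _ ≤ ‖LinearMap.toContinuousLinearMap T‖ * ‖x‖ * ‖x‖ := by
        gcongr
        exact (LinearMap.toContinuousLinearMap T).le_opNorm x
      _ = _ := by ring
  have h2 := (le_ciSup hb ⟨v, hv⟩).trans h1
  have hv' : 0 < ‖v‖ := norm_pos_iff.2 hv
  rw [div_le_iff₀ (by positivity)] at h2
  rwa [← hT v v]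

/-! ### Form bounds and continuity for the secular map -/

section

variable {E : Type*} [Fintype E]

theorem dtn_isSymmetric (l : E → ℝ) (κ : ℝ) : (dtn l κ).IsSymmetric := by
  intro v w
  simp only [PiLp.inner_apply, Fintype.sum_sum_type, dtn_inl, dtn_inr, RCLike.inner_apply,
    map_sub, map_mul, Complex.conj_ofReal, ← Finset.sum_add_distrib]
  exact Finset.sum_congr rfl fun e _ => by ring

theorem re_inner_dtn (l : E → ℝ) (κ : ℝ) (v : BoundarySpace E) :
    (inner ℂ v (dtn l κ v)).re = ∑ e, (dtnDiag (l e) κ *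
      (‖v (Sum.inl e)‖ ^ 2 + ‖v (Sum.inr e)‖ ^ 2) -
      2 * dtnOff (l e) κ * (inner ℂ (v (Sum.inl e)) (v (Sum.inr e))).re) := by
  simp only [PiLp.inner_apply, Fintype.sum_sum_type, dtn_inl, dtn_inr, ← Finset.sum_add_distrib,
    Complex.re_sum]
  refine Finset.sum_congr rfl fun e _ => ?_
  simp only [RCLike.inner_apply, ← Complex.normSq_eq_norm_sq, Complex.normSq_apply]
  simp
  ring

theorem norm_sq_boundarySpace (v : BoundarySpace E) :
    ‖v‖ ^ 2 = ∑ e, (‖v (Sum.inl e)‖ ^ 2 + ‖v (Sum.inr e)‖ ^ 2) := by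
  rw [EuclideanSpace.norm_sq_eq, Fintype.sum_sum_type, Finset.sum_add_distrib]

theorem two_mul_abs_re_inner_le (y z : ℂ) : 2 * |(inner ℂ y z).re| ≤ ‖y‖ ^ 2 + ‖z‖ ^ 2 := by
  have h1 : |(inner ℂ y z).re| ≤ ‖y‖ * ‖z‖ :=
    (Complex.abs_re_le_norm _).trans (norm_inner_le_norm y z)
  nlinarith [sq_nonneg (‖y‖ - ‖z‖)]

/-- The form splits over the edges into 2×2 blocks whose extreme eigenvalues are `dtnDiag ∓ dtnOff`;
the cross term is absorbed by `2 |Re ⟨y, z⟩| ≤ ‖y‖² + ‖z‖²`. The upper bound `re_inner_dtn_le` holds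
for the same reason. -/
theorem le_re_inner_dtn {l : E → ℝ} {κ c : ℝ} (h0 : ∀ e, 0 ≤ dtnOff (l e) κ)
    (hc : ∀ e, c ≤ dtnDiag (l e) κ - dtnOff (l e) κ) (v : BoundarySpace E) :
    c * ‖v‖ ^ 2 ≤ (inner ℂ v (dtn l κ v)).re := by
  rw [re_inner_dtn, norm_sq_boundarySpace, Finset.mul_sum]
  refine Finset.sum_le_sum fun e _ => ?_
  have h1 := two_mul_abs_re_inner_le (v (Sum.inl e)) (v (Sum.inr e))
  have h2 := le_abs_self (inner ℂ (v (Sum.inl e)) (v (Sum.inr e))).re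
  have h3 := mul_le_mul_of_nonneg_left (h1.trans' (mul_le_mul_of_nonneg_left h2 zero_le_two)) (h0 e)
  have h4 := mul_le_mul_of_nonneg_right (hc e)
    (by positivity : 0 ≤ ‖v (Sum.inl e)‖ ^ 2 + ‖v (Sum.inr e)‖ ^ 2)
  linarith

theorem re_inner_dtn_le {l : E → ℝ} {κ c : ℝ} (h0 : ∀ e, 0 ≤ dtnOff (l e) κ)
    (hc : ∀ e, dtnDiag (l e) κ + dtnOff (l e) κ ≤ c) (v : BoundarySpace E) :
    (inner ℂ v (dtn l κ v)).re ≤ c * ‖v‖ ^ 2 := by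
  rw [re_inner_dtn, norm_sq_boundarySpace, Finset.mul_sum]
  refine Finset.sum_le_sum fun e _ => ?_
  have h1 := two_mul_abs_re_inner_le (v (Sum.inl e)) (v (Sum.inr e))
  have h2 := neg_le_abs (inner ℂ (v (Sum.inl e)) (v (Sum.inr e))).re
  have h3 := mul_le_mul_of_nonneg_left (h1.trans' (mul_le_mul_of_nonneg_left h2 zero_le_two)) (h0 e)
  have h4 := mul_le_mul_of_nonneg_right (hc e)
    (by positivity : 0 ≤ ‖v (Sum.inl e)‖ ^ 2 + ‖v (Sum.inr e)‖ ^ 2)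
  linarith

variable (B : BoundaryConditions E)

theorem BoundaryConditions.inner_Q (v : LinearMap.ker B.P) (w : BoundarySpace E) :
    inner ℂ v (B.Q w) = inner ℂ (v : BoundarySpace E) w := by
  have : inner ℂ (v : BoundarySpace E) (B.P w) = 0 := by
    rw [← B.isProjection.isSymmetric v w, LinearMap.mem_ker.1 v.2, inner_zero_left]
  rw [Submodule.coe_inner, B.Q_coe, inner_sub_right, this, sub_zero]

theorem BoundaryConditions.L_isSymmetric :
    LinearMap.IsSymmetric (𝕜 := ℂ) (E := LinearMap.ker B.P) B.L :=
  fun v w => B.isSelfAdjoint v w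

theorem BoundaryConditions.inner_secular (l : E → ℝ) (κ : ℝ) (v w : LinearMap.ker B.P) :
    inner ℂ v (B.secular l κ w) =
      inner ℂ (v : BoundarySpace E) (dtn l κ w) - inner ℂ v (B.L w) := by
  rw [← B.inner_Q]
  exact inner_sub_right (𝕜 := ℂ) (E := LinearMap.ker B.P) v (B.Q (dtn l κ w)) (B.L w)

theorem BoundaryConditions.secular_isSymmetric (l : E → ℝ) (κ : ℝ) :
    LinearMap.IsSymmetric (𝕜 := ℂ) (E := LinearMap.ker B.P) (B.secular l κ) := by
  intro v w
  rw [← inner_conj_symm (𝕜 := ℂ) (E := LinearMap.ker B.P), B.inner_secular, B.inner_secular,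
    map_sub, inner_conj_symm, inner_conj_symm (𝕜 := ℂ) (E := LinearMap.ker B.P),
    dtn_isSymmetric, B.L_isSymmetric]

theorem continuousOn_dtnOff {a : ℝ} (ha : 0 < a) : ContinuousOn (dtnOff a) (Ioi 0) := by
  unfold dtnOff
  exact ContinuousOn.div (by fun_prop) (by fun_prop)
    fun κ hκ => (Real.sinh_pos_iff.2 (mul_pos hκ ha)).ne'

theorem continuousOn_dtnDiag {a : ℝ} (ha : 0 < a) : ContinuousOn (dtnDiag a) (Ioi 0) := by
  unfold dtnDiag
  exact ContinuousOn.div (by fun_prop) (by fun_prop)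
    fun κ hκ => (Real.sinh_pos_iff.2 (mul_pos hκ ha)).ne'

theorem BoundaryConditions.continuousOn_inner_secular {l : E → ℝ} (hl : ∀ e, 0 < l e) :
    ContinuousOn (fun p : ℝ × LinearMap.ker B.P => (inner ℂ p.2 (B.secular l p.1 p.2)).re)
      (Ioi 0 ×ˢ univ) := by
  simp only [B.inner_secular, Complex.sub_re, re_inner_dtn]
  have hL : Continuous fun p : ℝ × LinearMap.ker B.P => (inner ℂ p.2 (B.L p.2)).re :=
    Complex.continuous_re.comp (Continuous.inner (𝕜 := ℂ) (E := LinearMap.ker B.P)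
      continuous_snd ((LinearMap.continuous_of_finiteDimensional (E := LinearMap.ker B.P) B.L).comp
        continuous_snd))
  have hv (i : E ⊕ E) :
      Continuous fun p : ℝ × LinearMap.ker B.P => (p.2 : BoundarySpace E) i := by fun_prop
  refine ContinuousOn.sub (continuousOn_finsetSum _ fun e _ => ?_) hL.continuousOn
  have h1 : ContinuousOn (fun p : ℝ × LinearMap.ker B.P => dtnDiag (l e) p.1) (Ioi 0 ×ˢ univ) :=
    (continuousOn_dtnDiag (hl e)).comp continuousOn_fst fun p hp => hp.1
  have h2 : ContinuousOn (fun p : ℝ × LinearMap.ker B.P => dtnOff (l e) p.1) (Ioi 0 ×ˢ univ) :=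
    (continuousOn_dtnOff (hl e)).comp continuousOn_fst fun p hp => hp.1
  exact (h1.mul (by fun_prop)).sub ((continuousOn_const.mul h2).mul
    (Complex.continuous_re.comp ((hv _).inner (hv _))).continuousOn)

end

/-! ### Monotonicity and long-edge limits of the block eigenvalues -/

theorem dtnOff_nonneg {a κ : ℝ} (ha : 0 < a) (hκ : 0 < κ) : 0 ≤ dtnOff a κ :=
  div_nonneg hκ.le (Real.sinh_pos_iff.2 (mul_pos hκ ha)).le

theorem exp_neg_mul_lt_one {a κ : ℝ} (ha : 0 < a) (hκ : 0 < κ) : Real.exp (-(κ * a)) < 1 :=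
  Real.exp_lt_one_iff.2 (neg_lt_zero.2 (mul_pos hκ ha))

/-- This is `κ tanh (κ a / 2)`, written through `exp (-(κ a))` so that its growth in `κ` and its
limit for long edges are visible. The sum `dtnDiag + dtnOff` is likewise `κ coth (κ a / 2)`. -/
theorem dtnDiag_sub_dtnOff {a κ : ℝ} (ha : 0 < a) (hκ : 0 < κ) :
    dtnDiag a κ - dtnOff a κ = κ * ((1 - Real.exp (-(κ * a))) / (1 + Real.exp (-(κ * a)))) := by
  have hs := (Real.sinh_pos_iff.2 (mul_pos hκ ha)).ne'
  have he : Real.exp (κ * a) * Real.exp (-(κ * a)) = 1 := by rw [← Real.exp_add]; simp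
  have h1 : 1 + Real.exp (-(κ * a)) ≠ 0 := by positivity
  rw [dtnDiag, dtnOff, ← sub_div, ← mul_sub_one, mul_div_assoc]
  congr 1
  rw [div_eq_div_iff hs h1, Real.cosh_eq, Real.sinh_eq]
  linear_combination he

theorem dtnDiag_add_dtnOff {a κ : ℝ} (ha : 0 < a) (hκ : 0 < κ) :
    dtnDiag a κ + dtnOff a κ = κ * ((1 + Real.exp (-(κ * a))) / (1 - Real.exp (-(κ * a)))) := by
  have hs := (Real.sinh_pos_iff.2 (mul_pos hκ ha)).ne'
  have he : Real.exp (κ * a) * Real.exp (-(κ * a)) = 1 := by rw [← Real.exp_add]; simp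
  have h1 : 1 - Real.exp (-(κ * a)) ≠ 0 := (sub_pos.2 (exp_neg_mul_lt_one ha hκ)).ne'
  rw [dtnDiag, dtnOff, ← add_div, ← mul_add_one, mul_div_assoc]
  congr 1
  rw [div_eq_div_iff hs h1, Real.cosh_eq, Real.sinh_eq]
  linear_combination -he

/-- Carries a lower bound on the form from `κ = b` to every `κ ≥ b`. -/
theorem dtnDiag_sub_dtnOff_mono {a κ κ' : ℝ} (ha : 0 < a) (hκ : 0 < κ) (h : κ ≤ κ') :
    dtnDiag a κ - dtnOff a κ ≤ dtnDiag a κ' - dtnOff a κ' := by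
  have hκ' := hκ.trans_le h
  rw [dtnDiag_sub_dtnOff ha hκ, dtnDiag_sub_dtnOff ha hκ']
  have h1 := exp_neg_mul_lt_one ha hκ
  have h2 : Real.exp (-(κ' * a)) ≤ Real.exp (-(κ * a)) := by gcongr
  have h3 : 0 ≤ 1 - Real.exp (-(κ' * a)) := by linarith
  gcongr

theorem tendsto_exp_neg_mul_mul {a κ : ℝ} (ha : 0 < a) (hκ : 0 < κ) :
    Tendsto (fun η : ℝ => Real.exp (-(κ * (η * a)))) atTop (𝓝 0) :=
  Real.tendsto_exp_neg_atTop_nhds_zero.comp ((tendsto_id.atTop_mul_const ha).const_mul_atTop hκ)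

theorem tendsto_dtnDiag_sub_dtnOff {a κ : ℝ} (ha : 0 < a) (hκ : 0 < κ) :
    Tendsto (fun η : ℝ => dtnDiag (η * a) κ - dtnOff (η * a) κ) atTop (𝓝 κ) := by
  have h := tendsto_exp_neg_mul_mul ha hκ
  have h1 := (((h.const_sub 1).div (h.const_add 1) (by norm_num)).const_mul κ)
  norm_num at h1
  refine h1.congr' ?_
  filter_upwards [eventually_gt_atTop 0] with η hη
  exact (dtnDiag_sub_dtnOff (mul_pos hη ha) hκ).symm

theorem tendsto_dtnDiag_add_dtnOff {a κ : ℝ} (ha : 0 < a) (hκ : 0 < κ) :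
    Tendsto (fun η : ℝ => dtnDiag (η * a) κ + dtnOff (η * a) κ) atTop (𝓝 κ) := by
  have h := tendsto_exp_neg_mul_mul ha hκ
  have h1 := (((h.const_add 1).div (h.const_sub 1) (by norm_num)).const_mul κ)
  norm_num at h1
  refine h1.congr' ?_
  filter_upwards [eventually_gt_atTop 0] with η hη
  exact (dtnDiag_add_dtnOff (mul_pos hη ha) hκ).symm

/-! ### Locating the ground state -/

/-- At `a` the Dirichlet-to-Neumann form is at most `m`, so the secular form is nonpositive on an
eigenvector of `L` for `m`. From `b` on it is at least `c > m`, which dominates `L`. The largest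
singular parameter therefore lies in `[a, b]`. -/
theorem exists_isLeast_eigenvalues {V E : Type*} [Fintype E] (Γ : MetricGraph V E)
    (B : BoundaryConditions E) {m a b c : ℝ} (hm : IsGreatest B.eigenvaluesL m) (ha0 : 0 < a)
    (hab : a ≤ b) (ha : ∀ e, dtnDiag (Γ.length e) a + dtnOff (Γ.length e) a ≤ m) (hc : m < c)
    (hb : ∀ e, c ≤ dtnDiag (Γ.length e) b - dtnOff (Γ.length e) b) :
    ∃ κ ∈ Icc a b, IsLeast (eigenvalues (Γ.laplacian B)) (-κ ^ 2) := by
  obtain ⟨v, hv⟩ := hm.1.exists_hasEigenvector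
  obtain ⟨κ, hκ, ⟨-, hsing⟩, hmax⟩ := exists_isGreatest_singular
    (K := LinearMap.ker B.P) (T := B.secular Γ.length)
    (B.secular_isSymmetric _) ((B.continuousOn_inner_secular Γ.length_pos).mono
      (prod_mono_left fun κ hκ => ha0.trans_le hκ.1)) hab
    ⟨v, hv.2, by
      have h1 := re_inner_dtn_le (fun e => dtnOff_nonneg (Γ.length_pos e) ha0) ha v
      have h2 : inner ℂ v (B.L v) = ((m * ‖v‖ ^ 2 : ℝ) : ℂ) := by
        rw [hv.apply_eq_smul, Submodule.coe_inner, Submodule.coe_smul, inner_smul_right,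
          inner_self_eq_norm_sq_to_K]
        push_cast
        rfl
      rw [B.inner_secular, h2, Complex.sub_re, Complex.ofReal_re]
      exact sub_nonpos.2 h1⟩
    (fun κ hκ w hw => by
      rw [B.inner_secular, Complex.sub_re, sub_pos]
      have hb0 := ha0.trans_le hab
      have h1 := re_inner_le_of_forall_hasEigenvalue
        (K := LinearMap.ker B.P) B.L_isSymmetric (fun μ h => hm.2 h) w
      have h2 := le_re_inner_dtn (fun e => dtnOff_nonneg (Γ.length_pos e) (hb0.trans_le hκ))
        (fun e => (hb e).trans (dtnDiag_sub_dtnOff_mono (Γ.length_pos e) hb0 hκ)) w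
      have h3 : 0 < ‖w‖ := norm_pos_iff.2 hw
      have h4 : m * ‖w‖ ^ 2 < c * ‖w‖ ^ 2 := by gcongr
      exact (h1.trans_lt h4).trans_le h2)
  have hκ0 := ha0.trans_le hκ.1
  refine ⟨κ, hκ, (neg_sq_mem_eigenvalues_iff B Γ hκ0).2 hsing, fun μ hμ => ?_⟩
  -- An eigenvalue `μ < -κ ^ 2` is negative, so `√(-μ)` would be a singular parameter larger than
  -- `κ`.
  by_contra! hlt
  have hμ0 : 0 ≤ -μ := by nlinarith
  have hsq : -√(-μ) ^ 2 = μ := by rw [Real.sq_sqrt hμ0, neg_neg]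
  have hκμ : κ < √(-μ) := Real.lt_sqrt_of_sq_lt (by linarith)
  rw [← hsq, neg_sq_mem_eigenvalues_iff B Γ (hκ0.trans hκμ)] at hμ
  exact absurd (hmax ⟨hκ.1.trans hκμ.le, hμ⟩) hκμ.not_ge

end QuantumGraph

theorem mainTheorem4 {V E : Type*} [Finite V] [Fintype E]
    (Γ : QuantumGraph.MetricGraph V E) (B : QuantumGraph.BoundaryConditions E)
    (Lmax : ℝ) (hLmax : IsGreatest B.eigenvaluesL Lmax) (hpos : 0 < Lmax) :
    ∃ κ : ℝ → ℝ,
      (∀ᶠ η in atTop, ∃ hη : 0 < η, 0 < κ η ∧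
        IsLeast (QuantumGraph.eigenvalues ((Γ.scale η hη).laplacian B)) (-(κ η) ^ 2)) ∧
      Tendsto (fun η => -(κ η) ^ 2) atTop (𝓝 (-Lmax ^ 2)) := by
  classical
  have key (a b : ℝ) (ha : 0 < a) (haL : a < Lmax) (hbL : Lmax < b) :
      ∀ᶠ η in atTop, ∃ hη : 0 < η, ∃ κ ∈ Icc a b,
        IsLeast (QuantumGraph.eigenvalues ((Γ.scale η hη).laplacian B)) (-κ ^ 2) := by
    -- The lower block eigenvalue at `b` tends to `b`, so it eventually exceeds any `c < b`. Since
    -- there are finitely many edges, one threshold for `η` serves them all.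
    obtain ⟨c, hLc, hcb⟩ := exists_between hbL
    have h1 : ∀ᶠ η in atTop, ∀ e, QuantumGraph.dtnDiag (η * Γ.length e) a +
        QuantumGraph.dtnOff (η * Γ.length e) a ≤ Lmax := eventually_all.2 fun e =>
      (QuantumGraph.tendsto_dtnDiag_add_dtnOff (Γ.length_pos e) ha).eventually_le_const haL
    have h2 : ∀ᶠ η in atTop, ∀ e, c ≤ QuantumGraph.dtnDiag (η * Γ.length e) b -
        QuantumGraph.dtnOff (η * Γ.length e) b := eventually_all.2 fun e =>
      (QuantumGraph.tendsto_dtnDiag_sub_dtnOff (Γ.length_pos e)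
        (hpos.trans hbL)).eventually_const_le hcb
    filter_upwards [h1, h2, eventually_gt_atTop 0] with η h1 h2 hη
    exact ⟨hη, QuantumGraph.exists_isLeast_eigenvalues (Γ.scale η hη) B hLmax ha
      (haL.trans hbL).le h1 hLc h2⟩
  let p (η κ : ℝ) : Prop := ∃ hη : 0 < η, 0 < κ ∧
    IsLeast (QuantumGraph.eigenvalues ((Γ.scale η hη).laplacian B)) (-κ ^ 2)
  -- One function chosen independently of the bracket `[a, b]`. The value `0` is used only where no
  -- suitable `κ` exists, which does not happen for large `η`.
  let κ (η : ℝ) : ℝ := if h : ∃ κ, p η κ then h.choose else 0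
  have hκ (η : ℝ) (h : ∃ κ, p η κ) : p η (κ η) := by
    simp only [κ, dif_pos h]
    exact h.choose_spec
  have hmem (a b : ℝ) (ha : 0 < a) (haL : a < Lmax) (hbL : Lmax < b) :
      ∀ᶠ η in atTop, p η (κ η) ∧ κ η ∈ Icc a b := by
    filter_upwards [key a b ha haL hbL] with η ⟨hη, k, hk, hleast⟩
    have hk0 := ha.trans_le hk.1
    have h := hκ η ⟨k, hη, hk0, hleast⟩
    refine ⟨h, ?_⟩
    obtain ⟨_, h0, hleast'⟩ := h
    -- A least element is unique and both numbers are positive, so the chosen value is the one found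
    -- in the bracket.
    have : κ η = k :=
      (sq_eq_sq₀ h0.le hk0.le).1 (neg_injective (hleast'.unique hleast))
    rwa [this]
  refine ⟨κ, (hmem (Lmax / 2) (Lmax + 1) (by linarith) (by linarith) (by linarith)).mono
    fun η h => h.1, Tendsto.neg (Tendsto.pow ?_ 2)⟩
  rw [tendsto_order]
  constructor
  · intro a ha
    -- The given `a` may be nonpositive, whereas the lower end of a bracket must be positive.
    have hmax : max a (Lmax / 2) < Lmax := max_lt ha (by linarith)
    obtain ⟨a', h1, h2⟩ := exists_between hmax
    filter_upwards [hmem a' (Lmax + 1) (by linarith [le_max_right a (Lmax / 2)]) h2 (by linarith)]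
      with η h
    exact (le_max_left _ _).trans_lt (h1.trans_le h.2.1)
  · intro b hb
    obtain ⟨b', h1, h2⟩ := exists_between hb
    filter_upwards [hmem (Lmax / 2) b' (by linarith) (by linarith) h1] with η h
    exact h.2.2.trans_lt h2
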